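/- Let $N=\{1,\dots,n\}$ be a set of agents and $G$ a finite set of goods. Each agent $i\in N$ has a valuation $v_i:2^G\to\mathbb R$ that is a matroid rank function: $v_i(\emptyset)=0$; $\Delta_i(S,g):=v_i(S\cup\{g\})-v_i(S)\in\{0,1\}$ for all $S\subseteq G$, $g\in G$; and $\Delta_i(S,g)\ge\Delta_i(T,g)$ whenever $S\subseteq T\subseteq G$. An allocation is a partition $X=(X_0,X_1,\dots,X_n)$ of $G$ into (possibly empty) bundles, where $X_0$ is the set of unallocated goods. Put $v_0(S)=|S|$. The maximin share of agent $i$ is $\mathrm{MMS}_i=\max_{(B_1,\dots,B_n)}\min_{j\in N}v_i(B_j)$, the maximum being over all partitions of $G$ into $n$ (possibly empty) bundles. The exchange graph of $X$ is the directed graph on $G$ with an edge from $g\in X_k$ ($0\le k\le n$) to $g'\ne g$ whenever $v_k((X_k\setminus\{g\})\cup\{g'\})=v_k(X_k)$. For $i\in N$ let $F_i(X)=\{g\in G:\Delta_i(X_i,g)=1\}$. For a path $P=(g_1,\dots,g_t)$ in the exchange graph, let $X_k\Lambda P=(X_k\setminus\{g_t\})\oplus\{g_j,g_{j+1}:1\le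 j<t,\ g_j\in X_k\}$, where $\oplus$ is symmetric difference. Let $c_i=\mathrm{MMS}_i$ for every $i\in N$, and let $M>0$ be a real number with $M>v_i(S)/c_i$ for all $i$ with $c_i>0$ and all $S\subseteq G$. Define the fair-share gain function by $$\phi(X,i)=\begin{cases}\left(-\frac{v_i(X_i)}{c_i},\,-c_i\right)&\text{if }c_i>0,\\(-M,0)&\text{if }c_i=0,\end{cases}$$ with values compared lexicographically. General Yankee Swap with gain function $\phi$ starts with $X=(G,\emptyset,\dots,\emptyset)$ and $U=N$ and, while $U\neq\emptyset$, repeats the following. Let $i$ be the agent of least index among those maximizing $\phi(X,\cdot)$ over $U$. If the exchange graph of $X$ has a path from $F_i(X)$ to $X_0$ (possibly consisting of a single good), take any shortest such path $P=(g_1,\dots,g_t)$, and replace $X_i$ by $(X_i\Lambda P)\cup\{g_1\}$ and $X_k$ by $X_k\Lambda P$ for every other $k\in\{0,1,\dots,n\}$. Otherwise remove $i$ from $U$. When $U=\emptyset$, output $X$. Then General Yankee Swap with this $\phi$ always terminates and, whichever shortest paths are chosen, its output $X$ is an allocation that maximizes the utilitarian social welfare, i.e. $\sum_{i\in N}v_i(Y_i)\le\sum_{i\in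 N}v_i(X_i)$ for every allocation $Y$, and in which every agent receives at least their maximin share, i.e. $v_i(X_i)\ge\mathrm{MMS}_i$ for all $i\in N$. -/

import Mathlib

open scoped symmDiff

namespace YankeeSwap

/-- `v` is a matroid rank function on the subsets of `G`: it vanishes on the empty set, has
marginal gains in `{0, 1}`, and has decreasing marginal gains. -/
structure IsMRF {G : Type*} [DecidableEq G] (v : Finset G → ℝ) : Prop where
  empty : v ∅ = 0
  marginal : ∀ (S : Finset G) (g : G), v (insert g S) - v S = 0 ∨ v (insert g S) - v S = 1
  submodular : ∀ (S T : Finset G) (g : G), S ⊆ T →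
    v (insert g T) - v T ≤ v (insert g S) - v S

/-- A family of bundles: `X (some i)` is the bundle of agent `i` and `X none` is the set of
unallocated goods (the bundle of the dummy agent). -/
abbrev Bundles (n : ℕ) (G : Type*) := Option (Fin n) → Finset G

/-- `X` is an allocation: its `n + 1` bundles partition the set of goods. -/
def IsAllocation {n : ℕ} {G : Type*} (X : Bundles n G) : Prop :=
  (∀ k l, k ≠ l → Disjoint (X k) (X l)) ∧ ∀ g, ∃ k, g ∈ X k

/-- The utility vector of `X`. -/
def utility {n : ℕ} {G : Type*} (v : Fin n → Finset G → ℝ) (X : Bundles n G) : Fin n → ℝ :=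
  fun i => v i (X (some i))

/-- Valuations of all agents including the dummy agent, who values a set by its cardinality. -/
def extVal {n : ℕ} {G : Type*} (v : Fin n → Finset G → ℝ) : Option (Fin n) → Finset G → ℝ
  | none => fun S => (S.card : ℝ)
  | some i => v i

/-- Edges of the exchange graph of `X`: the owner `k` of `g` (possibly the dummy agent) does not
lose utility when `g` is replaced by another good `g'`. -/
def ExchangeEdge {n : ℕ} {G : Type*} [DecidableEq G] (v : Fin n → Finset G → ℝ)
    (X : Bundles n G) (g g' : G) : Prop :=
  g ≠ g' ∧ ∃ k, g ∈ X k ∧ extVal v k (insert g' ((X k).erase g)) = extVal v k (X k)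

/-- The goods that give agent `i` a marginal gain of `1`. -/
def desired {n : ℕ} {G : Type*} [DecidableEq G] (v : Fin n → Finset G → ℝ)
    (X : Bundles n G) (i : Fin n) : Set G :=
  {g | v i (insert g (X (some i))) - v i (X (some i)) = 1}

/-- `P` lists the vertices of a path in the exchange graph of `X` from a good desired by agent `i`
to an unallocated good. -/
def IsTransferPath {n : ℕ} {G : Type*} [DecidableEq G] (v : Fin n → Finset G → ℝ)
    (X : Bundles n G) (i : Fin n) (P : List G) : Prop :=
  P.IsChain (ExchangeEdge v X) ∧ (∃ g ∈ P.head?, g ∈ desired v X i) ∧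
    ∃ g ∈ P.getLast?, g ∈ X none

/-- `P` is a shortest such path. -/
def IsShortestTransferPath {n : ℕ} {G : Type*} [DecidableEq G] (v : Fin n → Finset G → ℝ)
    (X : Bundles n G) (i : Fin n) (P : List G) : Prop :=
  IsTransferPath v X i P ∧ ∀ Q, IsTransferPath v X i Q → P.length ≤ Q.length

/-- The effect of augmentation along `P = (g₁, …, g_t)` on a bundle `S`: the symmetric difference
of `S - g_t` with `{g_j, g_{j+1} : j < t, g_j ∈ S}`. -/
def augmentBundle {G : Type*} [DecidableEq G] (S : Finset G) (P : List G) : Finset G :=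
  (S \ P.getLast?.toFinset) ∆
    ((P.zip P.tail).toFinset.filter (fun e => e.1 ∈ S)).biUnion (fun e => {e.1, e.2})

/-- Augmentation of all bundles along `P`, after which agent `i` receives the first good
of `P`. -/
def augment {n : ℕ} {G : Type*} [DecidableEq G] (X : Bundles n G) (i : Fin n) (P : List G) :
    Bundles n G :=
  fun k => if k = some i then augmentBundle (X k) P ∪ P.head?.toFinset
    else augmentBundle (X k) P

/-- `i` is the least index among the agents of `U` that maximize `φ u`. -/
def IsChosen {n : ℕ} {β : Type*} [LinearOrder β] (φ : (Fin n → ℝ) → Fin n → β)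
    (u : Fin n → ℝ) (U : Finset (Fin n)) (i : Fin n) : Prop :=
  i ∈ U ∧ (∀ j ∈ U, φ u j ≤ φ u i) ∧ ∀ j ∈ U, φ u j = φ u i → i ≤ j

/-- A state of the algorithm: the current bundles and the set of agents still in play. -/
structure State (n : ℕ) (G : Type*) where
  X : Bundles n G
  U : Finset (Fin n)

/-- Initially all goods are unallocated and all agents are in play. -/
def State.init (n : ℕ) (G : Type*) [Fintype G] : State n G where
  X := fun k => match k with
    | none => Finset.univ
    | some _ => ∅
  U := Finset.univ

/-- One iteration of the main loop of General Yankee Swap with gain function `φ`. Any shortest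
path may be used. There is no iteration from a state in which no agent is in play. -/
inductive Step {n : ℕ} {G : Type*} [DecidableEq G] {β : Type*} [LinearOrder β]
    (v : Fin n → Finset G → ℝ) (φ : (Fin n → ℝ) → Fin n → β) : State n G → State n G → Prop
  | transfer (s : State n G) (i : Fin n) (P : List G)
      (hi : IsChosen φ (utility v s.X) s.U i) (hP : IsShortestTransferPath v s.X i P) :
      Step v φ s ⟨augment s.X i P, s.U⟩
  | remove (s : State n G) (i : Fin n)
      (hi : IsChosen φ (utility v s.X) s.U i) (hP : ¬ ∃ P, IsTransferPath v s.X i P) :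
      Step v φ s ⟨s.X, s.U.erase i⟩

/-- `s` occurs in some execution of General Yankee Swap. -/
def Reachable {n : ℕ} {G : Type*} [Fintype G] [DecidableEq G] {β : Type*} [LinearOrder β]
    (v : Fin n → Finset G → ℝ) (φ : (Fin n → ℝ) → Fin n → β) (s : State n G) : Prop :=
  Relation.ReflTransGen (Step v φ) (State.init n G) s

/-- `X` is an output of General Yankee Swap. -/
def IsOutput {n : ℕ} {G : Type*} [Fintype G] [DecidableEq G] {β : Type*} [LinearOrder β]
    (v : Fin n → Finset G → ℝ) (φ : (Fin n → ℝ) → Fin n → β) (X : Bundles n G) : Prop :=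
  Reachable v φ ⟨X, ∅⟩

/-- General Yankee Swap terminates: no execution is infinite, and no execution gets stuck while
some agent is still in play. -/
def Terminates {n : ℕ} {G : Type*} [Fintype G] [DecidableEq G] {β : Type*} [LinearOrder β]
    (v : Fin n → Finset G → ℝ) (φ : (Fin n → ℝ) → Fin n → β) : Prop :=
  (¬ ∃ r : ℕ → State n G, r 0 = State.init n G ∧ ∀ t, Step v φ (r t) (r (t + 1))) ∧
    ∀ s, Reachable v φ s → s.U ≠ ∅ → ∃ s', Step v φ s s'

/-- The maximin share of agent `i`: the maximum, over all divisions `f` of the goods into `n`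
bundles, of the value to `i` of the worst bundle. (The index types are finite and nonempty.) -/
noncomputable def maximinShare {n : ℕ} {G : Type*} [Fintype G]
    (v : Fin n → Finset G → ℝ) (i : Fin n) : ℝ :=
  ⨆ f : G → Fin n, ⨅ j : Fin n, v i (Finset.univ.filter (fun g => f g = j))

/-- The fair-share gain function for the shares `c` and the large number `M`; its values are
pairs of reals compared lexicographically. -/
noncomputable def fairShareGain {n : ℕ} (c : Fin n → ℝ) (M : ℝ) (u : Fin n → ℝ) (i : Fin n) :
    ℝ ×ₗ ℝ :=
  if 0 < c i then toLex (-(u i / c i), -c i) else toLex (-M, 0)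

/-- `X` maximizes utilitarian social welfare among all allocations. -/
def IsMaxUSW {n : ℕ} {G : Type*} (v : Fin n → Finset G → ℝ) (X : Bundles n G) : Prop :=
  IsAllocation X ∧ ∀ Y : Bundles n G, IsAllocation Y → ∑ i, utility v Y i ≤ ∑ i, utility v X i

/-- `X` is an allocation in which every agent receives at least their maximin share. -/
def IsMMS {n : ℕ} {G : Type*} [Fintype G] (v : Fin n → Finset G → ℝ) (X : Bundles n G) : Prop :=
  IsAllocation X ∧ ∀ i, maximinShare v i ≤ utility v X i

end YankeeSwap

/-! All bundles of agents stay independent throughout, so values are cardinalities. Augmentation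
along a shortest path amounts to a series of single exchanges with the pool of unallocated goods,
made from the end of the path backwards. It gives the chosen agent one more good and keeps every
other bundle's size (`IsShortcutFree.augment`). Each step therefore hands out a good or removes an
agent, which gives termination.

The guarantees rest on `exists_saturated`. If some agents have no transfer path, let `T` be the set
of goods not reachable from what they desire. These agents, and all owners of goods outside `T`,
have their bundle's trace on `T` spanning `T`, and all goods outside `T` are allocated. Counting
goods outside `T` then shows three things: without transfer paths welfare is maximal; a stuck agent
cannot gain unless another loses; a stuck agent has her maximin share if nobody exceeds theirs.

The gain function supplies the last condition: while an agent in play is below her share, only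
agents below their share are chosen, and integrality of shares prevents overshooting. `Invariant`
records this. -/

namespace YankeeSwap

/-! ### Rank, span and exchange in matroids. -/

namespace IsMRF

variable {G : Type*} [DecidableEq G] {v : Finset G → ℝ}

theorem le_insert (h : IsMRF v) (S : Finset G) (g : G) : v S ≤ v (insert g S) := by
  rcases h.marginal S g with h | h <;> linarith

theorem insert_le (h : IsMRF v) (S : Finset G) (g : G) : v (insert g S) ≤ v S + 1 := by
  rcases h.marginal S g with h | h <;> linarith

theorem mono (h : IsMRF v) {S T : Finset G} (hST : S ⊆ T) : v S ≤ v T := by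
  rw [← Finset.union_eq_right.mpr hST]
  clear hST
  induction T using Finset.induction_on with
  | empty => simp
  | insert g T _ ih =>
    rw [Finset.union_insert]
    exact ih.trans (h.le_insert _ _)

theorem union_le (h : IsMRF v) (S T : Finset G) : v (S ∪ T) ≤ v S + T.card := by
  induction T using Finset.induction_on with
  | empty => simp
  | insert g T hg ih =>
    rw [Finset.union_insert, Finset.card_insert_of_notMem hg]
    push_cast
    linarith [h.insert_le (S ∪ T) g]

theorem le_card (h : IsMRF v) (S : Finset G) : v S ≤ S.card := by
  simpa [h.empty] using h.union_le ∅ S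

theorem nonneg (h : IsMRF v) (S : Finset G) : 0 ≤ v S := by
  rw [← h.empty]
  exact h.mono S.empty_subset

theorem exists_nat (h : IsMRF v) (S : Finset G) : ∃ m : ℕ, v S = m := by
  induction S using Finset.induction_on with
  | empty => exact ⟨0, by simp [h.empty]⟩
  | insert g S _ ih =>
    obtain ⟨m, hm⟩ := ih
    rcases h.marginal S g with h | h
    · exact ⟨m, by linarith⟩
    · exact ⟨m + 1, by push_cast; linarith⟩

/-- Adding `g` to two nested sets of equal rank gives sets of equal rank. -/
theorem insert_congr (h : IsMRF v) {S T : Finset G} (hST : S ⊆ T) (he : v S = v T) (g : G) :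
    v (insert g S) = v (insert g T) :=
  le_antisymm (h.mono (Finset.insert_subset_insert g hST))
    (by linarith [h.submodular S T g hST])

/-- A set whose elements have no marginal value adds no value. -/
theorem union_eq (h : IsMRF v) {S A : Finset G} (hA : ∀ g ∈ A, v (insert g S) = v S) :
    v (S ∪ A) = v S := by
  induction A using Finset.induction_on with
  | empty => simp
  | insert g A _ ih =>
    rw [Finset.union_insert]
    have h1 := ih fun x hx => hA x (Finset.mem_insert_of_mem hx)
    rw [← h.insert_congr Finset.subset_union_left h1.symm, hA g (Finset.mem_insert_self _ _)]

/-- Subsets of independent sets are independent. -/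
theorem indep_subset (h : IsMRF v) {I J : Finset G} (hI : v I = I.card) (hJ : J ⊆ I) :
    v J = J.card := by
  refine le_antisymm (h.le_card J) ?_
  have h1 := h.union_le J (I \ J)
  rw [Finset.union_sdiff_of_subset hJ, hI] at h1
  have h2 := Finset.card_sdiff_add_card_eq_card hJ
  have h3 : ((I \ J).card : ℝ) + J.card = I.card := by exact_mod_cast h2
  linarith

/-- Exchanging `a` for `b` in an independent set `I` keeps the rank of `insert g (I.erase x)`
for every `g`, provided that `b` is spanned by `I.erase x`. -/
theorem insert_erase_exchange (h : IsMRF v) {I : Finset G} (hI : v I = I.card) {a b x : G}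
    (ha : a ∈ I) (hb : b ∉ I) (hx : x ∈ I) (hxa : x ≠ a)
    (hab : v (insert b (I.erase a)) = v I) (hxb : v (insert b (I.erase x)) ≠ v I) (g : G) :
    v (insert g ((insert b (I.erase a)).erase x)) = v (insert g (I.erase x)) := by
  have hxb' : x ≠ b := fun e => hb (e ▸ hx)
  have hcx : ((I.erase x).card : ℝ) = I.card - 1 := by
    rw [Finset.card_erase_of_mem hx, Nat.cast_pred (Finset.card_pos.mpr ⟨x, hx⟩)]
  have hw : v (I.erase x) = I.card - 1 := by
    rw [h.indep_subset hI (Finset.erase_subset _ _), hcx]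
  have hc : (insert b (I.erase a)).card = I.card := by
    rw [Finset.card_insert_of_notMem (by simp [hb]), Finset.card_erase_add_one ha]
  have hw' : v ((insert b (I.erase a)).erase x) = I.card - 1 := by
    rw [h.indep_subset (by rw [hab, hI, hc]) (Finset.erase_subset _ _),
      Finset.card_erase_of_mem (by simp [hx, hxa]), hc,
      Nat.cast_pred (Finset.card_pos.mpr ⟨x, hx⟩)]
  have hwb : v (insert b (I.erase x)) = I.card - 1 := by
    rcases h.marginal (I.erase x) b with h1 | h1
    · linarith
    · exact absurd (by rw [hI]; linarith) hxb
  -- Both sets lie in `insert b (I.erase x)` and have its rank `I.card - 1`, so all three have the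
  -- same span.
  rw [h.insert_congr (Finset.subset_insert b (I.erase x)) (hw.trans hwb.symm),
    h.insert_congr (T := insert b (I.erase x)) _ (hw'.trans hwb.symm)]
  intro y
  simp only [Finset.mem_erase, Finset.mem_insert]
  tauto

/-- Exchanging `a` for `b` in an independent set `I` keeps the rank of `insert g I` for every
`g`, provided that `b` is spanned by `I`. -/
theorem insert_exchange (h : IsMRF v) {I : Finset G} {a b : G}
    (hab : v (insert b (I.erase a)) = v I) (hb : v (insert b I) = v I) (g : G) :
    v (insert g (insert b (I.erase a))) = v (insert g I) := by
  rw [h.insert_congr (Finset.subset_insert b I) hb.symm,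
    h.insert_congr (Finset.insert_subset_insert b (Finset.erase_subset a I)) (hab.trans hb.symm)]

/-- If `g` is spanned by an independent set `I` and by each `I.erase x` with `x ∈ D`, then it
is spanned by `I \ D`. -/
theorem insert_sdiff (h : IsMRF v) {I : Finset G} (hI : v I = I.card) {g : G}
    (hg : v (insert g I) = v I) {D : Finset G} (hD : D ⊆ I)
    (hx : ∀ x ∈ D, v (insert g (I.erase x)) ≠ v I) :
    v (insert g (I \ D)) = v (I \ D) := by
  induction D using Finset.induction_on with
  | empty => simpa using hg
  | insert x D hxD ih =>
    have hxI : x ∈ I := hD (Finset.mem_insert_self _ _)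
    have ih' := ih ((Finset.subset_insert _ _).trans hD)
      fun y hy => hx y (Finset.mem_insert_of_mem hy)
    have e : insert x (I \ insert x D) = I \ D := by
      ext y
      simp only [Finset.mem_insert, Finset.mem_sdiff, not_or]
      by_cases hyx : y = x <;> simp_all
    have hn : x ∉ I \ insert x D := by simp
    have h1 : v (I \ insert x D) = v (I \ D) - 1 := by
      rw [h.indep_subset hI Finset.sdiff_subset, h.indep_subset hI Finset.sdiff_subset, ← e,
        Finset.card_insert_of_notMem hn]
      push_cast
      ring
    have h2 : v (insert g (I.erase x)) = v I - 1 := by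
      have h3 : v (I.erase x) = v I - 1 := by
        rw [h.indep_subset hI (Finset.erase_subset _ _), hI, Finset.card_erase_of_mem hxI,
          Nat.cast_pred (Finset.card_pos.mpr ⟨x, hxI⟩)]
      rcases h.marginal (I.erase x) g with h4 | h4
      · linarith
      · exact absurd (by linarith) (hx x (Finset.mem_insert_self _ _))
    have h3 : insert g (I \ insert x D) ⊆ insert g (I.erase x) := by
      apply Finset.insert_subset_insert
      intro y
      simp only [Finset.mem_sdiff, Finset.mem_insert, Finset.mem_erase, not_or]
      tauto
    -- Restoring `x` raises the rank of `insert g (I.erase x)` by one, hence also that of the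
    -- smaller `insert g (I \ insert x D)`. This leaves no room for `g` to add rank before `x` is
    -- restored.
    have h4 := h.submodular _ _ x h3
    rw [Finset.insert_comm x g, Finset.insert_comm x g, Finset.insert_erase hxI, e, hg, h2,
      ih'] at h4
    exact le_antisymm (by linarith) (h.le_insert _ _)

end IsMRF

/-! ### Augmentation along shortest paths. -/

section Augmentation

variable {n : ℕ} {G : Type*} {v : Fin n → Finset G → ℝ} {X Y : Bundles n G} {i : Fin n}
  {P : List G}

/-- An allocation in which every bundle of an agent is independent. -/
structure IsCleanAllocation (v : Fin n → Finset G → ℝ) (X : Bundles n G) : Prop where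
  alloc : IsAllocation X
  clean : ∀ i, v i (X (some i)) = (X (some i)).card

theorem IsAllocation.eq_of_mem (h : IsAllocation X) {k l : Option (Fin n)} {g : G}
    (hk : g ∈ X k) (hl : g ∈ X l) : k = l := by
  by_contra hkl
  exact Finset.disjoint_left.mp (h.1 k l hkl) hk hl

theorem mem_zip_tail_iff {a b : G} :
    (a, b) ∈ P.zip P.tail ↔ ∃ A C, P = A ++ a :: b :: C := by
  induction P with
  | nil => simp
  | cons x P ih =>
    cases P with
    | nil =>
      simp only [List.tail_cons, List.zip_nil_right, List.not_mem_nil, false_iff]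
      rintro ⟨A, C, h⟩
      have := congrArg List.length h
      simp at this
      omega
    | cons y P =>
      simp only [List.tail_cons, List.zip_cons_cons, List.mem_cons, Prod.mk.injEq] at ih ⊢
      rw [ih]
      constructor
      · rintro (⟨rfl, rfl⟩ | ⟨A, C, h⟩)
        · exact ⟨[], P, rfl⟩
        · exact ⟨x :: A, C, by rw [h]; rfl⟩
      · rintro ⟨A, C, h⟩
        cases A with
        | nil => simp_all
        | cons z A =>
          right
          simp only [List.cons_append, List.cons.injEq] at h
          exact ⟨A, C, h.2⟩

variable [DecidableEq G]

/-- A path in the exchange graph of `X` from a good desired by `i` to an unallocated good,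
such that neither an initial or final segment nor a shortcut gives a shorter one. -/
structure IsShortcutFree (v : Fin n → Finset G → ℝ) (X : Bundles n G) (i : Fin n)
    (P : List G) : Prop where
  edge : ∀ A x y C, P = A ++ x :: y :: C → ExchangeEdge v X x y
  head : ∃ g ∈ P.head?, g ∈ desired v X i
  last : ∃ g ∈ P.getLast?, g ∈ X none
  no_shortcut : ∀ A x B y C, P = A ++ x :: (B ++ y :: C) → B ≠ [] → ¬ ExchangeEdge v X x y
  init : ∀ A g C, P = A ++ g :: C → C ≠ [] → g ∉ X none
  tail : ∀ A g C, P = A ++ g :: C → A ≠ [] → g ∉ desired v X i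

/-- Any violation yields a shorter transfer path. The weaker notion is the one that can be shown to
survive the removal of the last edge, as the induction in `IsShortcutFree.augment` requires. -/
theorem IsShortestTransferPath.isShortcutFree (h : IsShortestTransferPath v X i P) :
    IsShortcutFree v X i P := by
  obtain ⟨⟨hc, hh, hl⟩, hmin⟩ := h
  refine ⟨?_, hh, hl, ?_, ?_, ?_⟩
  · rintro A x y C rfl
    exact (List.isChain_append_cons_cons.mp hc).2.1
  · rintro A x B y C rfl hB hxy
    have h1 := hmin (A ++ x :: y :: C) ⟨?_, ?_, ?_⟩
    · have := List.length_pos_iff.mpr hB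
      simp only [List.length_append, List.length_cons] at h1
      omega
    · rw [List.isChain_append_cons_cons]
      refine ⟨(List.isChain_split.mp hc).1, hxy, ?_⟩
      have h2 := (List.isChain_split.mp hc).2
      rw [← List.cons_append] at h2
      exact (List.isChain_split.mp h2).2
    · cases A <;> simpa using hh
    · simpa [List.getLast?_append, List.getLast?_cons] using hl
  · rintro A g C rfl hC hg
    have h1 := hmin (A ++ [g]) ⟨(List.isChain_split.mp hc).1, ?_, by simpa using hg⟩
    · have := List.length_pos_iff.mpr hC
      simp only [List.length_append, List.length_cons, List.length_nil] at h1
      omega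
    · cases A <;> simpa using hh
  · rintro A g C rfl hA hg
    have h1 := hmin (g :: C) ⟨(List.isChain_split.mp hc).2, by simpa using hg, ?_⟩
    · have := List.length_pos_iff.mpr hA
      simp only [List.length_append, List.length_cons] at h1
      omega
    · simpa [List.getLast?_append, List.getLast?_cons] using hl

theorem IsCleanAllocation.exchangeEdge_iff (hX : IsCleanAllocation v X) {l : Option (Fin n)}
    {x g : G} (hx : x ∈ X l) :
    ExchangeEdge v X x g ↔ x ≠ g ∧ extVal v l (insert g ((X l).erase x)) = extVal v l (X l) := by
  refine and_congr_right fun _ => ⟨?_, fun h => ⟨l, hx, h⟩⟩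
  rintro ⟨k, hk, h⟩
  rwa [hX.alloc.eq_of_mem hx hk]

/-- If `b` were in the bundle already, the exchange would only delete `a`, which lowers the value of
an independent bundle. -/
theorem IsCleanAllocation.notMem_of_exchangeEdge (hv : ∀ i, IsMRF (v i))
    (hX : IsCleanAllocation v X) {l : Option (Fin n)} {a b : G} (h : ExchangeEdge v X a b)
    (ha : a ∈ X l) : b ∉ X l := by
  intro hb
  obtain ⟨hab, h⟩ := (hX.exchangeEdge_iff ha).mp h
  rw [Finset.insert_eq_of_mem (Finset.mem_erase.mpr ⟨hab.symm, hb⟩)] at h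
  have hlt : (((X l).erase a).card : ℝ) < (X l).card := by
    exact_mod_cast Finset.card_erase_lt_of_mem ha
  cases l with
  | none => exact hlt.ne h
  | some k =>
    have h1 := (hv k).le_card ((X (some k)).erase a)
    have h2 : v k ((X (some k)).erase a) = v k (X (some k)) := h
    rw [h2, hX.clean k] at h1
    linarith

/-- Every good on the path passes to the owner of its predecessor, and the first one to agent `i`.
Consecutive goods have different owners, so nothing cancels wrongly in the symmetric difference. -/
theorem mem_augment_iff (hv : ∀ i, IsMRF (v i)) (hX : IsCleanAllocation v X)
    (hP : IsShortcutFree v X i P) {g : G} {l : Option (Fin n)} :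
    g ∈ augment X i P l ↔ (g ∉ P ∧ g ∈ X l) ∨
      (∃ a, (∃ A C, P = A ++ a :: g :: C) ∧ a ∈ X l) ∨ (P.head? = some g ∧ l = some i) := by
  obtain ⟨b, hb, hbX⟩ := hP.last
  have hb : P.getLast? = some b := hb
  have key : g ∈ augmentBundle (X l) P ↔ (g ∉ P ∧ g ∈ X l) ∨
      (∃ a, (∃ A C, P = A ++ a :: g :: C) ∧ a ∈ X l) := by
    simp only [augmentBundle, Finset.mem_symmDiff, Finset.mem_sdiff, hb, Option.toFinset_some,
      Finset.mem_singleton, Finset.mem_biUnion, Finset.mem_filter, List.mem_toFinset,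
      Finset.mem_insert, Prod.exists, mem_zip_tail_iff]
    constructor
    · rintro (⟨⟨hg, hgb⟩, hne⟩ | ⟨⟨a, c, ⟨⟨A, C, hPe⟩, ha⟩, rfl | rfl⟩, hng⟩)
      · refine Or.inl ⟨fun hgP => hne ?_, hg⟩
        obtain ⟨A, C, hPe⟩ := List.append_of_mem hgP
        cases C with
        | nil => simp [hPe] at hb; exact absurd hb hgb
        | cons c C => exact ⟨g, c, ⟨⟨A, C, hPe⟩, hg⟩, Or.inl rfl⟩
      · refine absurd ⟨ha, ?_⟩ hng
        rintro rfl
        exact hP.init _ _ _ hPe (by simp) hbX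
      · exact Or.inr ⟨a, ⟨A, C, hPe⟩, ha⟩
    · rintro (⟨hgP, hg⟩ | ⟨a, ⟨A, C, hPe⟩, ha⟩)
      · refine Or.inl ⟨⟨hg, ?_⟩, ?_⟩
        · rintro rfl
          exact hgP (List.mem_of_getLast? hb)
        · rintro ⟨a, c, ⟨⟨A, C, hPe⟩, ha⟩, rfl | rfl⟩ <;> simp [hPe] at hgP
      · refine Or.inr ⟨⟨a, g, ⟨⟨A, C, hPe⟩, ha⟩, Or.inr rfl⟩, fun h => ?_⟩
        exact hX.notMem_of_exchangeEdge hv (hP.edge _ _ _ _ hPe) ha h.1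
  unfold augment
  split_ifs with hl
  · rw [Finset.mem_union, key]
    simp only [Option.mem_toFinset, Option.mem_def, hl, and_true, or_assoc]
  · simp only [key, hl, and_false, or_false]

/-! ### Exchanging a single good with the pool. -/

/-- Agent `k` receives the unallocated good `b` in exchange for `a`. -/
def exchange (X : Bundles n G) (k : Fin n) (a b : G) : Bundles n G :=
  fun l => if l = some k then insert b ((X l).erase a)
    else if l = none then insert a ((X l).erase b) else X l

theorem mem_exchange_iff (hX : IsAllocation X) {k : Fin n} {a b g : G} (ha : a ∈ X (some k))
    (hb : b ∈ X none) {l : Option (Fin n)} :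
    g ∈ exchange X k a b l ↔
      (g ≠ a ∧ g ≠ b ∧ g ∈ X l) ∨ (g = b ∧ l = some k) ∨ (g = a ∧ l = none) := by
  have h1 : ∀ l, a ∈ X l → l = some k := fun l h => hX.eq_of_mem h ha
  have h2 : ∀ l, b ∈ X l → l = none := fun l h => hX.eq_of_mem h hb
  unfold exchange
  split_ifs with hl hl'
  · subst hl
    have : b ∉ X (some k) := fun h => by simpa using h2 _ h
    simp only [Finset.mem_insert, Finset.mem_erase, and_true, reduceCtorEq, and_false, or_false]
    by_cases hgb : g = b <;> simp_all
  · subst hl'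
    simp only [Finset.mem_insert, Finset.mem_erase, and_true, reduceCtorEq, and_false, false_or]
    by_cases hga : g = a <;> simp_all
  · simp only [hl, hl', and_false, or_false]
    refine ⟨fun h => ⟨?_, ?_, h⟩, fun h => h.2.2⟩
    · rintro rfl; exact hl (h1 _ h)
    · rintro rfl; exact hl' (h2 _ h)

theorem isAllocation_exchange (hX : IsAllocation X) {k : Fin n} {a b : G} (ha : a ∈ X (some k))
    (hb : b ∈ X none) : IsAllocation (exchange X k a b) := by
  have hab : a ≠ b := fun e =>
    Option.some_ne_none k (hX.eq_of_mem ha (e ▸ hb))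
  constructor
  · intro l m hlm
    rw [Finset.disjoint_left]
    intro g h1 h2
    rw [mem_exchange_iff hX ha hb] at h1 h2
    apply hlm
    rcases h1 with ⟨h3, h4, h5⟩ | ⟨rfl, rfl⟩ | ⟨rfl, rfl⟩ <;>
      rcases h2 with ⟨h6, h7, h8⟩ | ⟨h6, rfl⟩ | ⟨h6, rfl⟩ <;>
        first | rfl | exact hX.eq_of_mem h5 h8 | simp_all
  · intro g
    simp only [mem_exchange_iff hX ha hb]
    by_cases hga : g = a
    · exact ⟨none, by simp [hga]⟩
    by_cases hgb : g = b
    · exact ⟨some k, by simp [hgb]⟩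
    obtain ⟨l, hl⟩ := hX.2 g
    exact ⟨l, Or.inl ⟨hga, hgb, hl⟩⟩

theorem card_exchange (hX : IsAllocation X) {k : Fin n} {a b : G} (ha : a ∈ X (some k))
    (hb : b ∈ X none) (l : Option (Fin n)) : (exchange X k a b l).card = (X l).card := by
  unfold exchange
  split_ifs with hl hl'
  · subst hl
    rw [Finset.card_insert_of_notMem, Finset.card_erase_add_one ha]
    intro h
    simpa using hX.eq_of_mem hb (Finset.mem_of_mem_erase h)
  · subst hl'
    rw [Finset.card_insert_of_notMem, Finset.card_erase_add_one hb]
    intro h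
    simpa using hX.eq_of_mem ha (Finset.mem_of_mem_erase h)
  · rfl

theorem isCleanAllocation_exchange (hX : IsCleanAllocation v X) {k : Fin n} {a b : G}
    (ha : a ∈ X (some k)) (hb : b ∈ X none) (hab : ExchangeEdge v X a b) :
    IsCleanAllocation v (exchange X k a b) := by
  refine ⟨isAllocation_exchange hX.alloc ha hb, fun j => ?_⟩
  rw [card_exchange hX.alloc ha hb, ← hX.clean]
  by_cases hj : j = k
  · subst hj
    simpa [exchange, extVal] using ((hX.exchangeEdge_iff ha).mp hab).2
  · simp [exchange, hj]

/-- Only the case where `k` owns `x` needs an argument. The absence of a shortcut from `x` to `b`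
means that `b` is spanned by the bundle without `x`, so `insert_erase_exchange` applies. -/
theorem exchangeEdge_exchange_iff (hv : ∀ i, IsMRF (v i)) (hX : IsCleanAllocation v X)
    {k : Fin n} {a b x : G} (ha : a ∈ X (some k)) (hb : b ∈ X none)
    (hab : ExchangeEdge v X a b) (hx : x ∉ X none) (hxb : ¬ ExchangeEdge v X x b) (g : G) :
    ExchangeEdge v (exchange X k a b) x g ↔ ExchangeEdge v X x g := by
  have hxa : x ≠ a := by rintro rfl; exact hxb hab
  have hne : x ≠ b := by rintro rfl; exact hx hb
  obtain ⟨l, hl⟩ := hX.alloc.2 x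
  have hl' : x ∈ exchange X k a b l :=
    (mem_exchange_iff hX.alloc ha hb).mpr (Or.inl ⟨hxa, hne, hl⟩)
  rw [hX.exchangeEdge_iff hl,
    (isCleanAllocation_exchange hX ha hb hab).exchangeEdge_iff hl']
  cases l with
  | none => exact absurd hl hx
  | some m =>
    by_cases hm : m = k
    · subst hm
      have hb' : b ∉ X (some m) := fun h => by simpa using hX.alloc.eq_of_mem hb h
      have h1 := ((hX.exchangeEdge_iff ha).mp hab).2
      have h2 := mt (hX.exchangeEdge_iff hl).mpr hxb
      simp only [extVal, not_and] at h1 h2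
      have h3 := (hv m).insert_erase_exchange (hX.clean m) ha hb' hl hxa h1 (h2 hne) g
      simp only [extVal, exchange, if_true, h3, h1]
    · simp [exchange, hm]

/-- As `b` is not desired by `i`, it lies in the span of her bundle; if `k = i`, the exchange keeps
that span. -/
theorem desired_exchange (hv : ∀ i, IsMRF (v i)) (hX : IsCleanAllocation v X)
    {k : Fin n} {a b : G} (ha : a ∈ X (some k))
    (hab : ExchangeEdge v X a b) (hbi : b ∉ desired v X i) :
    desired v (exchange X k a b) i = desired v X i := by
  ext g
  by_cases hi : i = k
  · subst hi
    have h1 := ((hX.exchangeEdge_iff ha).mp hab).2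
    simp only [extVal] at h1
    have h2 : v i (insert b (X (some i))) = v i (X (some i)) := by
      have := ((hv i).marginal (X (some i)) b).resolve_right hbi
      linarith
    simp only [desired, exchange, if_true, Set.mem_ofPred_eq, (hv i).insert_exchange h1 h2, h1]
  · simp [desired, exchange, hi]

/-- Earlier goods have no edge to `b`, so their outgoing edges survive. None of them is `a`, which
does have such an edge and is now the unallocated endpoint. -/
theorem IsShortcutFree.exchange (hv : ∀ i, IsMRF (v i)) (hX : IsCleanAllocation v X)
    {Q : List G} {k : Fin n} {a b : G} (hP : IsShortcutFree v X i (Q ++ [a, b]))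
    (ha : a ∈ X (some k)) (hb : b ∈ X none) :
    IsShortcutFree v (exchange X k a b) i (Q ++ [a]) := by
  have hab : ExchangeEdge v X a b := hP.edge Q a b [] rfl
  have hbi : b ∉ desired v X i := hP.tail (Q ++ [a]) b [] (by simp) (by simp)
  have hd := desired_exchange hv hX ha hab hbi
  have hinit : ∀ x ∈ Q, x ∉ X none ∧ ¬ ExchangeEdge v X x b := by
    intro x hx
    obtain ⟨A, C, rfl⟩ := List.append_of_mem hx
    exact ⟨hP.init A x (C ++ [a, b]) (by simp) (by simp),
      hP.no_shortcut A x (C ++ [a]) b [] (by simp) (by simp)⟩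
  have hE : ∀ x ∈ Q, ∀ g, ExchangeEdge v (YankeeSwap.exchange X k a b) x g ↔
      ExchangeEdge v X x g := fun x hx =>
    exchangeEdge_exchange_iff hv hX ha hb hab (hinit x hx).1 (hinit x hx).2
  have hmem : ∀ A x C, Q ++ [a] = A ++ x :: C → C ≠ [] → x ∈ Q := by
    intro A x C h hC
    obtain ⟨D, z, rfl⟩ := List.eq_nil_or_concat C |>.resolve_left hC
    have h' : Q ++ [a] = (A ++ x :: D) ++ [z] := by simpa using h
    rw [(List.append_inj' h' rfl).1]
    simp
  have hext : ∀ A C, Q ++ [a] = A ++ C → Q ++ [a, b] = A ++ (C ++ [b]) := by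
    intro A C h
    rw [← List.append_assoc, ← h]
    simp
  refine ⟨?_, ?_, ⟨a, by simp, by simp [YankeeSwap.exchange]⟩, ?_, ?_, ?_⟩
  · intro A x y C h
    exact (hE x (hmem A x _ h (by simp)) y).mpr (hP.edge A x y _ (hext _ _ h))
  · rw [hd]
    cases Q <;> simpa using hP.head
  · intro A x B y C h hB
    rw [hE x (hmem A x _ h (by simp)) y]
    exact hP.no_shortcut A x B y (C ++ [b]) (by simpa using hext _ _ h) hB
  · intro A g C h hC hg
    have hgQ := hmem A g C h hC
    rw [mem_exchange_iff hX.alloc ha hb] at hg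
    rcases hg with h1 | h1 | h1
    · exact (hinit g hgQ).1 h1.2.2
    · simp at h1
    · exact (hinit g hgQ).2 (h1.1 ▸ hab)
  · intro A g C h hA
    rw [hd]
    exact hP.tail A g _ (hext _ _ h) hA

/-- The inductive step for augmentation: the last edge can be carried out first, as an exchange with
the pool. -/
theorem augment_append_pair (hv : ∀ i, IsMRF (v i)) (hX : IsCleanAllocation v X)
    {Q : List G} {k : Fin n} {a b : G} (hP : IsShortcutFree v X i (Q ++ [a, b]))
    (ha : a ∈ X (some k)) (hb : b ∈ X none) :
    augment X i (Q ++ [a, b]) = augment (exchange X k a b) i (Q ++ [a]) := by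
  have hab : ExchangeEdge v X a b := hP.edge Q a b [] rfl
  have hbQ : b ∉ Q ++ [a] := by
    intro h
    obtain ⟨A, C, h⟩ := List.append_of_mem h
    refine hP.init A b (C ++ [b]) ?_ (by simp) hb
    have : Q ++ [a, b] = (Q ++ [a]) ++ [b] := by simp
    simp [this, h]
  have haQ : ∀ x ∈ Q, x ≠ a := by
    rintro x hx rfl
    obtain ⟨A, C, rfl⟩ := List.append_of_mem hx
    exact hP.no_shortcut A x (C ++ [x]) b [] (by simp) (by simp) hab
  have hpair : ∀ c g, (∃ A C, Q ++ [a, b] = A ++ c :: g :: C) ↔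
      (∃ A C, Q ++ [a] = A ++ c :: g :: C) ∨ (c = a ∧ g = b) := by
    intro c g
    constructor
    · rintro ⟨A, C, h⟩
      rcases List.eq_nil_or_concat C with rfl | ⟨D, z, rfl⟩
      · have := List.append_inj' h rfl
        simp only [List.cons.injEq, and_true] at this
        exact Or.inr ⟨this.2.1.symm, this.2.2.symm⟩
      · have h' : (Q ++ [a]) ++ [b] = (A ++ c :: g :: D) ++ [z] := by simpa using h
        exact Or.inl ⟨A, D, (List.append_inj' h' rfl).1⟩
    · rintro (⟨A, C, h⟩ | ⟨rfl, rfl⟩)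
      · refine ⟨A, C ++ [b], ?_⟩
        have : Q ++ [a, b] = (Q ++ [a]) ++ [b] := by simp
        simp [this, h]
      · exact ⟨Q, [], rfl⟩
  have hmem : ∀ c g, (∃ A C, Q ++ [a] = A ++ c :: g :: C) → c ∈ Q := by
    rintro c g ⟨A, C, h⟩
    obtain ⟨D, z, hD⟩ := List.eq_nil_or_concat (g :: C) |>.resolve_left (by simp)
    have h' : Q ++ [a] = (A ++ c :: D) ++ [z] := by simpa [hD] using h
    rw [(List.append_inj' h' rfl).1]
    simp
  have hhead : (Q ++ [a, b]).head? = (Q ++ [a]).head? := by cases Q <;> rfl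
  have haX : ∀ l, a ∈ X l ↔ l = some k :=
    fun l => ⟨fun h => hX.alloc.eq_of_mem h ha, fun h => h ▸ ha⟩
  funext l
  ext g
  rw [mem_augment_iff hv hX hP, mem_augment_iff hv (isCleanAllocation_exchange hX ha hb hab)
    (hP.exchange hv hX ha hb), hhead, ← or_assoc, ← or_assoc]
  refine or_congr_left ?_
  have h1 : (g ∉ Q ++ [a] ∧ g ∈ exchange X k a b l) ↔
      (g ∉ Q ++ [a, b] ∧ g ∈ X l) ∨ (g = b ∧ l = some k) := by
    rw [mem_exchange_iff hX.alloc ha hb]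
    simp only [List.mem_append, List.mem_cons, List.not_mem_nil, or_false,
      not_or] at hbQ ⊢
    by_cases hgb : g = b
    · simp [hgb, hbQ.1, hbQ.2]
    · by_cases hga : g = a
      · simp [hga, Ne.symm hbQ.2]
      · simp [hga, hgb]
  have h2 : (∃ c, (∃ A C, Q ++ [a] = A ++ c :: g :: C) ∧ c ∈ exchange X k a b l) ↔
      ∃ c, (∃ A C, Q ++ [a] = A ++ c :: g :: C) ∧ c ∈ X l := by
    refine exists_congr fun c => and_congr_right fun hc => ?_
    have hcQ := hmem c g hc
    have hca := haQ c hcQ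
    have hcb : c ≠ b := by
      rintro rfl
      exact hbQ (by simp [hcQ])
    rw [mem_exchange_iff hX.alloc ha hb]
    simp [hca, hcb]
  rw [h1, h2]
  simp only [hpair, or_and_right, exists_or]
  have h3 : (∃ c, (c = a ∧ g = b) ∧ c ∈ X l) ↔ (g = b ∧ l = some k) := by
    simp [haX]
  rw [h3]
  exact (or_congr_right or_comm).trans or_assoc.symm

theorem augment_singleton (b : G) :
    augment X i [b] = fun l => if l = some i then insert b (X l) else (X l).erase b := by
  funext l
  ext g
  unfold augment
  split_ifs with hl
  · by_cases hg : g = b <;> simp [augmentBundle, Finset.mem_symmDiff, hg]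
  · simp [augmentBundle, Finset.mem_symmDiff, and_comm]

/-- Augmentation along a shortcut-free path gives agent `i` one more good, keeps the sizes of
all other agents' bundles, and keeps all bundles independent. -/
theorem IsShortcutFree.augment (hv : ∀ i, IsMRF (v i)) (hX : IsCleanAllocation v X)
    (hP : IsShortcutFree v X i P) : IsCleanAllocation v (augment X i P) ∧
      ∀ k, (YankeeSwap.augment X i P (some k)).card =
        (X (some k)).card + if k = i then 1 else 0 := by
  -- The path is consumed from its end. `X` must vary because each exchange changes the allocation.
  induction P using List.reverseRecOn generalizing X with
  | nil => simpa using hP.head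
  | append_singleton Q b ih =>
    have hb : b ∈ X none := by simpa using hP.last
    rcases List.eq_nil_or_concat Q with rfl | ⟨R, a, rfl⟩
    · have hd : v i (insert b (X (some i))) - v i (X (some i)) = 1 := by
        simpa [desired] using hP.head
      have hbX : ∀ k, b ∉ X (some k) := fun k h => Option.some_ne_none k (hX.alloc.eq_of_mem h hb)
      have hcard : ∀ k, (YankeeSwap.augment X i [b] (some k)).card =
          (X (some k)).card + if k = i then 1 else 0 := by
        intro k
        rw [augment_singleton]
        by_cases hk : k = i
        · subst hk
          simp [hbX]
        · simp [hk, hbX]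
      refine ⟨⟨⟨fun k l hkl => ?_, fun g => ?_⟩, fun k => ?_⟩, hcard⟩
      · rw [List.nil_append, augment_singleton]
        have h := hX.alloc.1 k l hkl
        rw [Finset.disjoint_left] at h ⊢
        intro g
        dsimp only
        have := @h g
        split_ifs with h1 h2 h2
        · exact absurd (h1.trans h2.symm) hkl
        · simp only [Finset.mem_insert, Finset.mem_erase]; tauto
        · simp only [Finset.mem_insert, Finset.mem_erase]; tauto
        · simp only [Finset.mem_erase]; tauto
      · rw [List.nil_append, augment_singleton]
        by_cases hg : g = b
        · exact ⟨some i, by simp [hg]⟩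
        · obtain ⟨l, hl⟩ := hX.alloc.2 g
          refine ⟨l, ?_⟩
          dsimp only
          split_ifs <;> simp [hg, hl]
      · rw [List.nil_append, hcard, augment_singleton]
        by_cases hk : k = i
        · subst hk
          simp only [if_true, Nat.cast_add, Nat.cast_one, ← hX.clean k]
          linarith
        · simp [hk, hbX, hX.clean k]
    · simp only [List.concat_eq_append, List.append_assoc, List.cons_append,
        List.nil_append] at hP ih ⊢
      obtain ⟨l, hl⟩ := hX.alloc.2 a
      have ha : a ∉ X none := hP.init R a [b] rfl (by simp)
      cases l with
      | none => exact absurd hl ha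
      | some k =>
        have hab : ExchangeEdge v X a b := hP.edge R a b [] rfl
        have := ih (isCleanAllocation_exchange hX hl hb hab) (hP.exchange hv hX hl hb)
        rw [augment_append_pair hv hX hP hl hb]
        simpa only [card_exchange hX.alloc hl hb] using this

end Augmentation

theorem exists_maximinShare_eq {n : ℕ} {G : Type*} [Fintype G] (v : Fin n → Finset G → ℝ)
    (i : Fin n) :
    ∃ f : G → Fin n, (∀ j, maximinShare v i ≤ v i (Finset.univ.filter fun g => f g = j)) ∧
      ∃ j, maximinShare v i = v i (Finset.univ.filter fun g => f g = j) := by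
  have : Nonempty (Fin n) := ⟨i⟩
  obtain ⟨f, hf⟩ := exists_eq_ciSup_of_finite
    (f := fun f : G → Fin n => ⨅ j : Fin n, v i (Finset.univ.filter fun g => f g = j))
  obtain ⟨j, hj⟩ := exists_eq_ciInf_of_finite
    (f := fun j : Fin n => v i (Finset.univ.filter fun g => f g = j))
  have hf' : (⨅ j : Fin n, v i (Finset.univ.filter fun g => f g = j)) = maximinShare v i := hf
  refine ⟨f, fun j => ?_, j, ?_⟩
  · rw [← hf']
    exact ciInf_le (Set.finite_range _).bddBelow j
  · rw [← hf', ← hj]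

/-! ### Reachable goods and counting arguments. -/

section Closure

variable {n : ℕ} {G : Type*} [Fintype G] [DecidableEq G] {v : Fin n → Finset G → ℝ}
  {X Y : Bundles n G} {i : Fin n}

/-- If no agent of `A` has a transfer path, then the goods that cannot be reached from a good
desired by an agent of `A` form a set `T` on which every agent of `A`, and every agent owning a
good outside `T`, already attains the full value of `T`. -/
theorem exists_saturated (hv : ∀ i, IsMRF (v i)) (hX : IsCleanAllocation v X)
    (A : Set (Fin n)) (hA : ∀ i ∈ A, ¬ ∃ P, IsTransferPath v X i P) :
    ∃ T : Finset G, X none ⊆ T ∧ ∀ k, k ∈ A ∨ ¬ X (some k) ⊆ T →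
      v k T = (X (some k) ∩ T).card := by
  classical
  -- `R` is reachability from the goods desired by agents of `A`; the set sought is its complement.
  let R : G → Prop := fun g =>
    ∃ i ∈ A, ∃ f ∈ desired v X i, Relation.ReflTransGen (ExchangeEdge v X) f g
  have hdes : ∀ i ∈ A, ∀ g ∈ desired v X i, R g := fun i hi g hg => ⟨i, hi, g, hg, .refl⟩
  have hstep : ∀ g g', R g → ExchangeEdge v X g g' → R g' :=
    fun g g' ⟨i, hi, f, hf, h⟩ hg => ⟨i, hi, f, hf, h.tail hg⟩
  refine ⟨Finset.univ.filter fun g => ¬ R g, ?_, ?_⟩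
  · intro g hg
    simp only [Finset.mem_filter, Finset.mem_univ, true_and]
    rintro ⟨i, hi, f, hf, h⟩
    obtain ⟨l, hl, hlast⟩ := List.exists_isChain_cons_of_relationReflTransGen h
    refine hA i hi ⟨f :: l, hl, by simpa using hf, g, ?_, hg⟩
    rw [List.getLast?_eq_getLast_of_ne_nil (by simp), hlast]
    rfl
  · intro k hk
    set T := Finset.univ.filter fun g => ¬ R g with hT
    have hmemT : ∀ g, g ∈ T ↔ ¬ R g := fun g => by simp [hT]
    have hinter : X (some k) ∩ T = X (some k) \ (X (some k)).filter R := by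
      ext g
      simp only [Finset.mem_inter, Finset.mem_sdiff, Finset.mem_filter, hmemT]
      exact and_congr_right fun h => by simp [h]
    have hspan : ∀ g ∈ T, v k (insert g (X (some k) ∩ T)) = v k (X (some k) ∩ T) := by
      intro g hg
      by_cases hgX : g ∈ X (some k)
      · rw [Finset.insert_eq_of_mem (Finset.mem_inter.mpr ⟨hgX, hg⟩)]
      rw [hmemT] at hg
      have hno : ∀ x ∈ (X (some k)).filter R,
          v k (insert g ((X (some k)).erase x)) ≠ v k (X (some k)) := by
        intro x hx h
        rw [Finset.mem_filter] at hx
        exact hg (hstep x g hx.2 ⟨fun e => hgX (e ▸ hx.1), some k, hx.1, h⟩)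
      rw [hinter]
      refine (hv k).insert_sdiff (hX.clean k) ?_ (Finset.filter_subset _ _) hno
      rcases (hv k).marginal (X (some k)) g with h | h
      · linarith
      rcases hk with hk | hk
      · exact absurd (hdes k hk g h) hg
      -- Here `k` owns a reachable good `x`. If `g` had marginal value one, it would by
      -- submodularity also make up for the loss of `x`, giving an edge from `x` to `g`.
      · obtain ⟨x, hx, hxT⟩ := Finset.not_subset.mp hk
        rw [hmemT, not_not] at hxT
        refine absurd ?_ (hno x (Finset.mem_filter.mpr ⟨hx, hxT⟩))
        have h1 := (hv k).submodular _ _ g (Finset.erase_subset x (X (some k)))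
        have h2 := (hv k).indep_subset (hX.clean k) (Finset.erase_subset x (X (some k)))
        have h3 : ((X (some k)).erase x).card + 1 = (X (some k)).card :=
          Finset.card_erase_add_one hx
        have h4 : (((X (some k)).erase x).card : ℝ) + 1 = (X (some k)).card := by
          exact_mod_cast h3
        have h5 := (hv k).insert_le ((X (some k)).erase x) g
        rw [hX.clean k]
        linarith
    rw [← (hv k).indep_subset (hX.clean k) Finset.inter_subset_left, ← (hv k).union_eq hspan,
      Finset.union_eq_right.mpr Finset.inter_subset_right]

theorem IsAllocation.sum_card_sdiff_le (hY : IsAllocation Y) (T : Finset G) :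
    ∑ k, (Y (some k) \ T).card ≤ Tᶜ.card := by
  rw [← Finset.card_biUnion]
  · apply Finset.card_le_card
    intro g
    simp
  · intro k _ l _ hkl
    exact (hY.1 _ _ (by simpa using hkl)).mono Finset.sdiff_subset Finset.sdiff_subset

theorem IsAllocation.sum_card_sdiff_eq (hX : IsAllocation X) {T : Finset G} (hT : X none ⊆ T) :
    ∑ k, (X (some k) \ T).card = Tᶜ.card := by
  refine le_antisymm (hX.sum_card_sdiff_le T) ?_
  refine (Finset.card_le_card (t := Finset.univ.biUnion fun k => X (some k) \ T) ?_).trans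
    Finset.card_biUnion_le
  intro g hg
  rw [Finset.mem_compl] at hg
  obtain ⟨l, hl⟩ := hX.2 g
  cases l with
  | none => exact absurd (hT hl) hg
  | some k => simp only [Finset.mem_biUnion, Finset.mem_sdiff]; exact ⟨k, by simp, hl, hg⟩

/-- An agent without a transfer path cannot gain unless another agent loses. -/
theorem card_le_of_no_transferPath (hv : ∀ i, IsMRF (v i)) (hX : IsCleanAllocation v X)
    (hi : ¬ ∃ P, IsTransferPath v X i P) (hY : IsCleanAllocation v Y)
    (hXY : ∀ k, (X (some k)).card ≤ (Y (some k)).card) :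
    (Y (some i)).card ≤ (X (some i)).card := by
  obtain ⟨T, hT, hsat⟩ := exists_saturated hv hX {i} (by simpa using hi)
  have hle : ∀ k, k = i ∨ ¬ X (some k) ⊆ T →
      (Y (some k) ∩ T).card ≤ (X (some k) ∩ T).card := by
    intro k hk
    have h1 := (hv k).mono (Finset.inter_subset_right : Y (some k) ∩ T ⊆ T)
    rw [hsat k hk, (hv k).indep_subset (hY.clean k) Finset.inter_subset_left] at h1
    exact_mod_cast h1
  -- An owner of goods outside `T` holds no more of `T` in `Y` than in `X`, so she must hold at
  -- least as much outside. For `i` this becomes strict, and `Y` would need more goods than `Tᶜ`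
  -- has.
  have hsd : ∀ k, (X (some k) \ T).card ≤ (Y (some k) \ T).card := by
    intro k
    by_cases hk : X (some k) ⊆ T
    · simp [Finset.sdiff_eq_empty_iff_subset.mpr hk]
    · have h1 := hle k (Or.inr hk)
      have h2 := Finset.card_inter_add_card_sdiff (X (some k)) T
      have h3 := Finset.card_inter_add_card_sdiff (Y (some k)) T
      have := hXY k
      omega
  by_contra! hlt
  have hlt' : (X (some i) \ T).card < (Y (some i) \ T).card := by
    have h1 := hle i (Or.inl rfl)
    have h2 := Finset.card_inter_add_card_sdiff (X (some i)) T
    have h3 := Finset.card_inter_add_card_sdiff (Y (some i)) T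
    omega
  have h1 := Finset.sum_lt_sum (fun k _ => hsd k) ⟨i, Finset.mem_univ i, hlt'⟩
  rw [hX.alloc.sum_card_sdiff_eq hT] at h1
  exact h1.not_ge (hY.alloc.sum_card_sdiff_le T)

/-- An allocation without transfer paths maximizes utilitarian social welfare. -/
theorem isMaxUSW_of_no_transferPath (hv : ∀ i, IsMRF (v i)) (hX : IsCleanAllocation v X)
    (h : ∀ i, ¬ ∃ P, IsTransferPath v X i P) : IsMaxUSW v X := by
  refine ⟨hX.alloc, fun Y hY => ?_⟩
  obtain ⟨T, hT, hsat⟩ := exists_saturated hv hX Set.univ fun i _ => h i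
  calc ∑ k, utility v Y k
      ≤ ∑ k, (((X (some k) ∩ T).card : ℝ) + (Y (some k) \ T).card) := by
        refine Finset.sum_le_sum fun k _ => ?_
        rw [← hsat k (Or.inl trivial)]
        refine ((hv k).mono ?_).trans ((hv k).union_le T _)
        rw [Finset.union_sdiff_self_eq_union]
        exact Finset.subset_union_right
    _ ≤ ∑ k, (((X (some k) ∩ T).card : ℝ) + (X (some k) \ T).card) := by
        rw [Finset.sum_add_distrib, Finset.sum_add_distrib]
        have h1 := hY.sum_card_sdiff_le T
        rw [← hX.alloc.sum_card_sdiff_eq hT] at h1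
        exact add_le_add_right (by exact_mod_cast h1) _
    _ = ∑ k, utility v X k := by
        refine Finset.sum_congr rfl fun k _ => ?_
        rw [utility, hX.clean k]
        exact_mod_cast Finset.card_inter_add_card_sdiff (X (some k)) T

theorem exists_maximinShare_eq_nat (hv : ∀ i, IsMRF (v i)) (i : Fin n) :
    ∃ m : ℕ, maximinShare v i = m := by
  obtain ⟨f, -, j, hj⟩ := exists_maximinShare_eq v i
  rw [hj]
  exact (hv i).exists_nat _

/-- In a division attaining the share, each of the `n` bundles gets at most `v i T` from inside `T`,
so it needs the remainder in goods outside `T`. -/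
theorem mul_maximinShare_sub_le (hv : ∀ i, IsMRF (v i)) (i : Fin n) (T : Finset G) :
    n * (maximinShare v i - v i T) ≤ Tᶜ.card := by
  obtain ⟨f, hf, -⟩ := exists_maximinShare_eq v i
  rw [Finset.card_eq_sum_card_fiberwise (f := f) (t := Finset.univ) (fun _ _ => by simp)]
  push_cast
  have h : ∀ j ∈ (Finset.univ : Finset (Fin n)), maximinShare v i - v i T ≤
      ((Tᶜ.filter fun g => f g = j).card : ℝ) := by
    intro j _
    rw [sub_le_iff_le_add']
    refine ((hf j).trans ((hv i).mono ?_)).trans ((hv i).union_le T _)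
    intro g hg
    by_cases hgT : g ∈ T <;> simp_all
  have h1 := Finset.sum_le_sum h
  rwa [Finset.sum_const, Finset.card_univ, Fintype.card_fin, nsmul_eq_mul] at h1

/-- An agent without a transfer path has at least her maximin share if no agent has more than
hers. -/
theorem maximinShare_le_of_no_transferPath (hv : ∀ i, IsMRF (v i)) (hX : IsCleanAllocation v X)
    (hi : ¬ ∃ P, IsTransferPath v X i P)
    (hle : ∀ k, ((X (some k)).card : ℝ) ≤ maximinShare v k) :
    maximinShare v i ≤ (X (some i)).card := by
  obtain ⟨T, hT, hsat⟩ := exists_saturated hv hX {i} (by simpa using hi)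
  by_contra! hlt
  have hn : (0 : ℝ) < n := by exact_mod_cast i.pos
  have hcard : ∀ k, ((X (some k) \ T).card : ℝ) = (X (some k)).card - (X (some k) ∩ T).card := by
    intro k
    rw [eq_sub_iff_add_eq, add_comm]
    exact_mod_cast Finset.card_inter_add_card_sdiff (X (some k)) T
  -- No agent has more than the average share of `Tᶜ`, and `i` has strictly less. Yet the bundles
  -- together cover `Tᶜ`, since `X none ⊆ T`.
  have h1 : ∀ k, n * ((X (some k) \ T).card : ℝ) ≤ Tᶜ.card := by
    intro k
    by_cases hk : X (some k) ⊆ T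
    · simp [Finset.sdiff_eq_empty_iff_subset.mpr hk]
    · refine le_trans ?_ (mul_maximinShare_sub_le hv k T)
      rw [hcard, hsat k (Or.inr hk)]
      exact mul_le_mul_of_nonneg_left (by linarith [hle k]) hn.le
  have h2 : n * ((X (some i) \ T).card : ℝ) < Tᶜ.card := by
    refine lt_of_lt_of_le ?_ (mul_maximinShare_sub_le hv i T)
    rw [hcard, hsat i (Or.inl rfl)]
    exact mul_lt_mul_of_pos_left (by linarith) hn
  have h3 := Finset.sum_lt_sum (fun k _ => h1 k) ⟨i, Finset.mem_univ i, h2⟩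
  rw [← Finset.mul_sum, ← Nat.cast_sum, hX.alloc.sum_card_sdiff_eq hT] at h3
  simp at h3

end Closure

/-! ### Termination and the invariant of the execution. -/

section Execution

variable {n : ℕ} {G : Type*} [DecidableEq G] {v : Fin n → Finset G → ℝ}
  {X : Bundles n G} {i : Fin n}

theorem exists_isShortestTransferPath (h : ∃ P, IsTransferPath v X i P) :
    ∃ P, IsShortestTransferPath v X i P := by
  obtain ⟨P, hP, hmin⟩ := exists_minimalFor_of_wellFoundedLT (IsTransferPath v X i) List.length h
  exact ⟨P, hP, fun Q hQ => (le_total _ _).elim id (hmin hQ)⟩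

theorem exists_isChosen {β : Type*} [LinearOrder β] (φ : (Fin n → ℝ) → Fin n → β)
    (u : Fin n → ℝ) {U : Finset (Fin n)} (hU : U.Nonempty) : ∃ i, IsChosen φ u U i := by
  obtain ⟨m, hm, hmax⟩ := U.exists_max_image (φ u) hU
  obtain ⟨i, hi, hmin⟩ := (U.filter fun j => φ u j = φ u m).exists_min_image id
    ⟨m, by simp [hm]⟩
  rw [Finset.mem_filter] at hi
  exact ⟨i, hi.1, fun j hj => hi.2 ▸ hmax j hj,
    fun j hj hji => hmin j (Finset.mem_filter.mpr ⟨hj, hji.trans hi.2⟩)⟩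

theorem exists_step {β : Type*} [LinearOrder β] (φ : (Fin n → ℝ) → Fin n → β) (s : State n G)
    (hs : s.U ≠ ∅) : ∃ s', Step v φ s s' := by
  obtain ⟨i, hi⟩ := exists_isChosen φ (utility v s.X) (Finset.nonempty_iff_ne_empty.mpr hs)
  by_cases h : ∃ P, IsTransferPath v s.X i P
  · obtain ⟨P, hP⟩ := exists_isShortestTransferPath h
    exact ⟨_, .transfer s i P hi hP⟩
  · exact ⟨_, .remove s i hi h⟩

theorem Step.isCleanAllocation {β : Type*} [LinearOrder β] {φ : (Fin n → ℝ) → Fin n → β}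
    (hv : ∀ i, IsMRF (v i)) {s s' : State n G} (h : Step v φ s s')
    (hs : IsCleanAllocation v s.X) : IsCleanAllocation v s'.X := by
  cases h with
  | transfer i P hi hP => exact (hP.isShortcutFree.augment hv hs).1
  | remove i hi hP => exact hs

/-- Each step hands out a good or removes an agent. -/
theorem Step.card_add_one {β : Type*} [LinearOrder β] {φ : (Fin n → ℝ) → Fin n → β}
    (hv : ∀ i, IsMRF (v i)) {s s' : State n G} (h : Step v φ s s')
    (hs : IsCleanAllocation v s.X) :
    ∑ k, (s.X (some k)).card + s'.U.card + 1 = ∑ k, (s'.X (some k)).card + s.U.card := by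
  cases h with
  | transfer i P hi hP =>
    simp only [(hP.isShortcutFree.augment hv hs).2, Finset.sum_add_distrib, Finset.sum_ite_eq',
      Finset.mem_univ, if_true]
    ring
  | remove i hi hP =>
    have := Finset.card_erase_add_one hi.1
    dsimp only
    omega

variable [Fintype G]

theorem isCleanAllocation_init (hv : ∀ i, IsMRF (v i)) :
    IsCleanAllocation v (State.init n G).X := by
  refine ⟨⟨?_, fun g => ⟨none, by simp [State.init]⟩⟩, fun i => by simp [State.init, (hv i).empty]⟩
  rintro (_ | k) (_ | l) hkl <;> simp_all [State.init]

theorem terminates {β : Type*} [LinearOrder β] (φ : (Fin n → ℝ) → Fin n → β)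
    (hv : ∀ i, IsMRF (v i)) : Terminates v φ := by
  refine ⟨?_, fun s _ hs => exists_step φ s hs⟩
  rintro ⟨r, h0, hr⟩
  have hclean : ∀ t, IsCleanAllocation v (r t).X := by
    intro t
    induction t with
    | zero => exact h0 ▸ isCleanAllocation_init hv
    | succ t ih => exact (hr t).isCleanAllocation hv ih
  -- Goods handed out plus agents removed increase by one per step, and together they are at most
  -- `Fintype.card G + n`.
  have hcount : ∀ t, t + (r t).U.card ≤ ∑ k, ((r t).X (some k)).card + n := by
    intro t
    induction t with
    | zero => simpa using ((r 0).U.card_le_univ).trans (by simp)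
    | succ t ih =>
      have := (hr t).card_add_one hv (hclean t)
      omega
  have hbound : ∀ t, ∑ k, ((r t).X (some k)).card ≤ Fintype.card G := by
    intro t
    simpa using (hclean t).alloc.sum_card_sdiff_le ∅
  have h1 := hcount (Fintype.card G + n + 1)
  have h2 := hbound (Fintype.card G + n + 1)
  omega

/-- If an agent in play is below her share, then so is the chosen agent. -/
theorem IsChosen.lt_share {c : Fin n → ℝ} {M : ℝ} {u : Fin n → ℝ} {U : Finset (Fin n)}
    {i j : Fin n} (hi : IsChosen (fairShareGain c M) u U i) (hj : j ∈ U) (huj : 0 ≤ u j)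
    (hM : u j / c j < M) (hlt : u j < c j) : u i < c i := by
  have hcj : 0 < c j := huj.trans_lt hlt
  have h := hi.2.1 j hj
  simp only [fairShareGain, hcj, if_true] at h
  have hlt' : u j / c j < 1 := (div_lt_one hcj).mpr hlt
  split_ifs at h with hci
  · rw [Prod.Lex.le_iff] at h
    have h1 : u i / c i ≤ u j / c j := by
      rcases h with h | h
      · exact (neg_lt_neg_iff.mp h).le
      -- On a tie in the first component only the equality of the ratios is needed.
      · exact (neg_inj.mp h.1).ge
    exact (div_lt_one hci).mp (h1.trans_lt hlt')
  -- An agent with nonpositive share has first component `-M`, strictly below that of `j`, and so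
  -- cannot be chosen.
  · rw [Prod.Lex.le_iff] at h
    rcases h with h | h
    · exact absurd (neg_lt_neg_iff.mp h) hM.not_gt
    · exact absurd (neg_inj.mp h.1) hM.ne

/-- The properties of a state that are maintained by General Yankee Swap with the fair-share
gain function. -/
structure Invariant (v : Fin n → Finset G → ℝ) (s : State n G) : Prop where
  clean : IsCleanAllocation v s.X
  stuck : ∀ i ∉ s.U, ∀ Y : Bundles n G, IsCleanAllocation v Y →
    (∀ k, (s.X (some k)).card ≤ (Y (some k)).card) → (Y (some i)).card ≤ (s.X (some i)).card
  share_le : ∀ i ∉ s.U, maximinShare v i ≤ (s.X (some i)).card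
  le_share : ∀ i ∈ s.U, ((s.X (some i)).card : ℝ) < maximinShare v i →
    ∀ k, ((s.X (some k)).card : ℝ) ≤ maximinShare v k

theorem Invariant.init (hv : ∀ i, IsMRF (v i)) : Invariant v (State.init n G) := by
  refine ⟨isCleanAllocation_init hv, by simp [State.init], by simp [State.init], ?_⟩
  intro i _ _ k
  obtain ⟨m, hm⟩ := exists_maximinShare_eq_nat hv k
  simp [State.init, hm]

theorem Invariant.step (hv : ∀ i, IsMRF (v i)) {c : Fin n → ℝ}
    (hc : ∀ i, c i = maximinShare v i) {M : ℝ}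
    (hM : ∀ i, 0 < c i → ∀ S : Finset G, v i S / c i < M) {s s' : State n G}
    (h : Step v (fairShareGain c M) s s') (hs : Invariant v s) : Invariant v s' := by
  cases h with
  | transfer i P hi hP =>
    obtain ⟨hclean, hcard⟩ := hP.isShortcutFree.augment hv hs.clean
    have hmono : ∀ k, (s.X (some k)).card ≤ (augment s.X i P (some k)).card := by
      intro k
      rw [hcard]
      exact Nat.le_add_right _ _
    refine ⟨hclean, fun j hj Y hY hXY => ?_, fun j hj => ?_, fun j hj hlt k => ?_⟩
    -- `stuck` speaks of all allocations `Y` with bundles at least as large, not of paths, so it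
    -- persists as bundle sizes grow.
    · exact (hs.stuck j hj Y hY fun k => (hmono k).trans (hXY k)).trans (hmono j)
    · exact (hs.share_le j hj).trans (by exact_mod_cast hmono j)
    · have hlt' : ((s.X (some j)).card : ℝ) < maximinShare v j :=
        lt_of_le_of_lt (by exact_mod_cast hmono j) hlt
      have hk := hs.le_share j hj hlt' k
      dsimp only
      rw [hcard]
      by_cases hki : k = i
      · subst hki
        rw [← hs.clean.clean j, ← hc] at hlt'
        have hcj : 0 < c j := ((hv j).nonneg _).trans_lt hlt'
        have h1 := hi.lt_share (j := j) hj ((hv j).nonneg _) (hM j hcj _) hlt'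
        -- The share is an integer, so a bundle strictly below it can take one more good without
        -- exceeding it.
        obtain ⟨m, hm⟩ := exists_maximinShare_eq_nat hv k
        rw [utility, hs.clean.clean k, hc, hm] at h1
        rw [if_pos rfl, hm]
        exact_mod_cast h1
      · simpa [hki] using hk
  | remove i hi hP =>
    refine ⟨hs.clean, fun j hj => ?_, fun j hj => ?_,
      fun j hj => hs.le_share j (Finset.mem_of_mem_erase hj)⟩
    · by_cases hji : j = i
      · subst hji
        exact fun Y hY hXY => card_le_of_no_transferPath hv hs.clean hP hY hXY
      · exact hs.stuck j fun h => hj (Finset.mem_erase.mpr ⟨hji, h⟩)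
    · by_cases hji : j = i
      · subst hji
        by_contra! hlt
        exact hlt.not_ge (maximinShare_le_of_no_transferPath hv hs.clean hP
          (hs.le_share j hi.1 hlt))
      · exact hs.share_le j fun h => hj (Finset.mem_erase.mpr ⟨hji, h⟩)

end Execution

end YankeeSwap

open YankeeSwap in
theorem mainTheorem8 {n : ℕ} {G : Type*} [Fintype G] [DecidableEq G]
    (v : Fin n → Finset G → ℝ) (hv : ∀ i, IsMRF (v i))
    (c : Fin n → ℝ) (hc : ∀ i, c i = maximinShare v i)
    (M : ℝ) (hM_pos : 0 < M) (hM : ∀ i, 0 < c i → ∀ S : Finset G, v i S / c i < M) :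
    Terminates v (fairShareGain c M) ∧
      ∀ X : Bundles n G, IsOutput v (fairShareGain c M) X → IsMaxUSW v X ∧ IsMMS v X := by
  refine ⟨terminates _ hv, fun X hX => ?_⟩
  have hinv : ∀ s, Reachable v (fairShareGain c M) s → Invariant v s := by
    intro s hs
    induction hs with
    | refl => exact .init hv
    | tail _ h ih => exact ih.step hv hc hM h
  have h := hinv _ hX
  refine ⟨isMaxUSW_of_no_transferPath hv h.clean fun i hi => ?_, h.clean.alloc, fun i => ?_⟩
  -- Augmenting along a remaining path would give `i` a further good with no bundle shrinking,
  -- against `stuck`.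
  · obtain ⟨P, hP⟩ := exists_isShortestTransferPath hi
    obtain ⟨hclean, hcard⟩ := hP.isShortcutFree.augment hv h.clean
    have h1 := h.stuck i (by simp) _ hclean fun k => by rw [hcard]; exact Nat.le_add_right _ _
    rw [hcard] at h1
    simp at h1
  · rw [utility, h.clean.clean i]
    exact h.share_le i (by simp)
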